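/- Let $N,m,l\ge 0$ and $n_1,\dots,n_N\ge 0$ be integers, $n=\sum_{i=1}^N n_i$, and let $\mathbb{R}^n=\mathbb{R}^{n_1}\times\cdots\times\mathbb{R}^{n_N}$ carry the Euclidean inner product; write $x=(x_1,\dots,x_N)=(x_i,x_{-i})\in\mathbb{R}^n$. Consider the $N$-player aggregative game in which player $i$ chooses $x_i$ in a local strategy set $\Omega_i\subseteq\mathbb{R}^{n_i}$ and has the cost $$J_i(x_i,x_{-i})=\vartheta_i(x_i,\sigma(x)),\qquad \sigma(x)=\frac1N\sum_{j=1}^N\varphi_j(x_j),$$ where $\varphi_j:\mathbb{R}^{n_j}\to\mathbb{R}^m$ and $\vartheta_i:\mathbb{R}^{n_i}\times\mathbb{R}^m\to\mathbb{R}$ are given functions. Let $$\Omega=\Omega_1\times\cdots\times\Omega_N,\qquad \mathcal{X}=\Big\{x\in\mathbb{R}^n:\ \sum_{i=1}^N A_ix_i=\sum_{i=1}^N b_i\Big\},\qquad \mathcal{K}=\Omega\cap\mathcal{X},$$ with $A_i\in\mathbb{R}^{l\times n_i}$ and $b_i\in\mathbb{R}^l$, and let the pseudo-gradient be $$F(x)=\big(\nabla_{x_1}J_1(x_1,x_{-1}),\dots,\nabla_{x_N}J_N(x_N,x_{-N})\big).$$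 A variational generalized Nash equilibrium (variational GNE) is a solution of the variational inequality $\mathrm{VI}(\mathcal{K},F)$, that is, a point $x^*\in\mathcal{K}$ such that $(y-x^*)^{T}F(x^*)\ge 0$ for all $y\in\mathcal{K}$. Assume that 1. every $J_i$ is twice continuously differentiable on a neighbourhood of $\Omega$ in $\mathbb{R}^n$; 2. $F$ is strictly monotone on $\Omega$: $(x-y)^{T}(F(x)-F(y))>0$ for all $x,y\in\Omega$ with $x\ne y$; 3. $\Omega$ is compact and convex; 4. $0$ lies in the relative interior of $\Omega-\mathcal{X}=\{z_1-z_2: z_1\in\Omega,\ z_2\in\mathcal{X}\}$. Then the game has exactly one variational GNE, i.e. $\mathrm{VI}(\mathcal{K},F)$ has exactly one solution. (If $N=0$, then $\mathbb{R}^n$ is a single point, and the factor $\frac1N$ plays no role.) -/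

import Mathlib

open scoped Pointwise

noncomputable section

/-- The solution set `SOL(K, F)` of the variational inequality `VI(K, F)`. -/
def viSolutions {E : Type*} [NormedAddCommGroup E] [InnerProductSpace ℝ E]
    (K : Set E) (F : E → E) : Set E :=
  {x | x ∈ K ∧ ∀ y ∈ K, 0 ≤ inner ℝ (y - x) (F x)}

/-- `F` is strictly monotone on the set `S`. -/
def StrictlyMonotoneOn {E : Type*} [NormedAddCommGroup E] [InnerProductSpace ℝ E]
    (F : E → E) (S : Set E) : Prop :=
  ∀ x ∈ S, ∀ y ∈ S, x ≠ y → 0 < inner ℝ (x - y) (F x - F y)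

/-- The space `ℝ^n = ℝ^{n_1} × ⋯ × ℝ^{n_N}` of strategy profiles `x = col(x_1, …, x_N)`,
with its Euclidean inner product. -/
abbrev Profile {N : ℕ} (n : Fin N → ℕ) : Type :=
  PiLp 2 (fun i : Fin N => EuclideanSpace ℝ (Fin (n i)))

/-- The data of an `N`-player aggregative game with linear coupled constraints: player `i` has
decisions in `ℝ^{n_i}`, the aggregate lies in `ℝ^m`, and there are `l` coupled constraints. -/
structure AggregativeGame (N m l : ℕ) (n : Fin N → ℕ) where
  /-- local strategy sets `Ω_i ⊆ ℝ^{n_i}` -/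
  localSet : ∀ i, Set (EuclideanSpace ℝ (Fin (n i)))
  /-- local contributions `φ_i : ℝ^{n_i} → ℝ^m` to the aggregate -/
  contrib : ∀ i, EuclideanSpace ℝ (Fin (n i)) → EuclideanSpace ℝ (Fin m)
  /-- the functions `ϑ_i : ℝ^{n_i} × ℝ^m → ℝ` -/
  theta : ∀ i, EuclideanSpace ℝ (Fin (n i)) → EuclideanSpace ℝ (Fin m) → ℝ
  /-- constraint matrices `A_i ∈ ℝ^{l × n_i}` -/
  A : ∀ i, Matrix (Fin l) (Fin (n i)) ℝ
  /-- constraint vectors `b_i ∈ ℝ^l` -/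
  b : Fin N → Fin l → ℝ

namespace AggregativeGame

variable {N m l : ℕ} {n : Fin N → ℕ} (G : AggregativeGame N m l n)

/-- The aggregation map `σ(x) = (1/N) ∑ φ_i(x_i)`. -/
def aggregate (x : Profile n) : EuclideanSpace ℝ (Fin m) :=
  (1 / (N : ℝ)) • ∑ i, G.contrib i (x i)

/-- The cost `J_i(x_i, x_{-i}) = ϑ_i(x_i, σ(x))`. -/
def cost (i : Fin N) (x : Profile n) : ℝ :=
  G.theta i (x i) (G.aggregate x)

/-- `Ω = Ω_1 × ⋯ × Ω_N`. -/
def strategySet : Set (Profile n) :=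
  {x | ∀ i, x i ∈ G.localSet i}

/-- `𝒳 = {x | ∑ A_i x_i = ∑ b_i}`. -/
def coupledSet : Set (Profile n) :=
  {x | ∑ i, (G.A i).mulVec (x i) = ∑ i, G.b i}

/-- The feasible strategy set `𝒦 = Ω ∩ 𝒳`. -/
def feasibleSet : Set (Profile n) :=
  G.strategySet ∩ G.coupledSet

/-- The profile `(y, x_{-i})`: `x` with its `i`-th component replaced by `y`. -/
def deviate (x : Profile n) (i : Fin N) (y : EuclideanSpace ℝ (Fin (n i))) : Profile n :=
  WithLp.toLp 2 (Function.update (fun j => x j) i y)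

/-- The pseudo-gradient `F(x) = col(∇_{x_1} J_1(·, x_{-1}), …, ∇_{x_N} J_N(·, x_{-N}))`. -/
def pseudoGradient (x : Profile n) : Profile n :=
  WithLp.toLp 2 (fun i => gradient (fun y => G.cost i (deviate x i y)) (x i))

/-- A variational GNE is a solution of `VI(𝒦, F)`. -/
def IsVariationalGNE (x : Profile n) : Prop :=
  x ∈ viSolutions G.feasibleSet G.pseudoGradient

end AggregativeGame

end

/-!
Strict monotonicity makes Brouwer's fixed point theorem unnecessary. For a monotone `F` and a
compact convex `K`, Minty's inequalities `0 ≤ ⟪y - x, F y⟫`, one for each `y ∈ K`, cut out closed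
subsets of `K`. By compactness they have a common point as soon as any finitely many of them do,
and for finitely many `y j` this follows from separating a compact convex set in `ℝ^ι` from the
nonnegative orthant: a separating functional has nonnegative coefficients `μ j`, and monotonicity
of `F` is contradicted at the barycentre of the `y j` with weights `μ j`
(`exists_minty_of_finite`). If `F` is continuous on `K`, a Minty point solves the variational
inequality (`mem_viSolutions_of_minty`).

The pseudo-gradient is continuous at every point of `Ω`, because its components are partial
gradients of `C²` functions (`AggregativeGame.continuousAt_pseudoGradient`). The constraint
qualification is needed only to see that the feasible set `Ω ∩ 𝒳` is nonempty.
-/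

open Filter Topology

/-! ### Monotone variational inequalities on compact convex sets -/

section VariationalInequality

variable {E : Type*} [NormedAddCommGroup E] [InnerProductSpace ℝ E]

/-- The diagonal value of the Minty bilinear form is nonnegative: symmetrizing the double sum turns
each term into a monotonicity inequality. -/
lemma sum_sum_mul_inner_nonneg {ι : Type*} [Fintype ι] {F : E → E} (y : ι → E) (μ : ι → ℝ)
    (hμ : ∀ j, 0 ≤ μ j) (hF : ∀ j k, 0 ≤ inner ℝ (y j - y k) (F (y j) - F (y k))) :
    0 ≤ ∑ j, ∑ k, μ j * μ k * inner ℝ (y j - y k) (F (y j)) := by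
  have hswap : ∑ j, ∑ k, μ j * μ k * inner ℝ (y j - y k) (F (y j))
      = ∑ j, ∑ k, μ j * μ k * inner ℝ (y k - y j) (F (y k)) := by
    rw [Finset.sum_comm]
    refine Finset.sum_congr rfl fun j _ => Finset.sum_congr rfl fun k _ => ?_
    ring
  have hsum : 0 ≤ ∑ j, ∑ k, μ j * μ k * inner ℝ (y j - y k) (F (y j))
      + ∑ j, ∑ k, μ j * μ k * inner ℝ (y k - y j) (F (y k)) := by
    rw [← Finset.sum_add_distrib]
    refine Finset.sum_nonneg fun j _ => ?_
    rw [← Finset.sum_add_distrib]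
    refine Finset.sum_nonneg fun k _ => ?_
    have h := mul_nonneg (mul_nonneg (hμ j) (hμ k)) (hF j k)
    have e : inner ℝ (y j - y k) (F (y j) - F (y k))
        = inner ℝ (y j - y k) (F (y j)) + inner ℝ (y k - y j) (F (y k)) := by
      rw [inner_sub_right, ← neg_sub (y j) (y k), inner_neg_left]
      ring
    rw [e] at h
    linarith
  linarith

/-- Finitely many Minty inequalities for a monotone map have a common solution. -/
lemma exists_minty_of_finite {ι : Type*} [Fintype ι] {K : Set E} {F : E → E}
    (hK : IsCompact K) (hconv : Convex ℝ K) (hne : K.Nonempty)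
    (hF : ∀ x ∈ K, ∀ y ∈ K, 0 ≤ inner ℝ (x - y) (F x - F y))
    (y : ι → E) (hy : ∀ j, y j ∈ K) :
    ∃ x ∈ K, ∀ j, 0 ≤ inner ℝ (y j - x) (F (y j)) := by
  classical
  by_contra! hno
  set Φ : E → ι → ℝ := fun x j => inner ℝ (y j - x) (F (y j)) with hΦ
  have hΦc : Continuous Φ := by fun_prop
  have hCconv : Convex ℝ (Φ '' K) := by
    rintro _ ⟨u, hu, rfl⟩ _ ⟨v, hv, rfl⟩ a b ha hb hab
    refine ⟨a • u + b • v, hconv hu hv ha hb hab, ?_⟩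
    ext j
    simp only [hΦ, Pi.add_apply, Pi.smul_apply, smul_eq_mul, inner_sub_left, inner_add_left,
      real_inner_smul_left]
    linear_combination -inner ℝ (y j) (F (y j)) * hab
  have hdisj : Disjoint (Φ '' K) (Set.Ici (0 : ι → ℝ)) := by
    rw [Set.disjoint_left]
    rintro _ ⟨u, hu, rfl⟩ h0
    obtain ⟨j, hj⟩ := hno u hu
    exact absurd (h0 j) (not_le.mpr hj)
  obtain ⟨f, s, t, hs, hst, ht⟩ := geometric_hahn_banach_compact_closed hCconv
    (hK.image hΦc) (convex_Ici 0) isClosed_Ici hdisj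
  have ht0 : t < 0 := by simpa using ht 0 (Set.mem_Ici.mpr le_rfl)
  set μ : ι → ℝ := fun j => f (Pi.single j 1) with hμdef
  have hfμ : ∀ v : ι → ℝ, f v = ∑ j, μ j * v j := fun v => by
    conv_lhs => rw [← Finset.univ_sum_single v]
    rw [map_sum]
    refine Finset.sum_congr rfl fun j _ => ?_
    have : (Pi.single j (v j) : ι → ℝ) = v j • Pi.single j (1 : ℝ) := by
      rw [← Pi.single_smul]; simp
    rw [this, map_smul, smul_eq_mul, mul_comm]
  -- A negative coefficient `μ j` would give a vector of the orthant, `t / μ j` times the `j`-th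
  -- coordinate vector, at which `f` takes the value `t`.
  have hμ : ∀ j, 0 ≤ μ j := fun j => by
    by_contra! hneg
    have h := ht ((t / μ j) • Pi.single j (1 : ℝ)) (by
      refine Set.mem_Ici.mpr (smul_nonneg (div_nonneg_of_nonpos ht0.le hneg.le) ?_)
      exact Pi.single_nonneg.mpr zero_le_one)
    rw [map_smul, smul_eq_mul, div_mul_cancel₀ _ hneg.ne] at h
    exact lt_irrefl _ h
  have hpos : 0 < ∑ j, μ j := by
    refine lt_of_le_of_ne (Finset.sum_nonneg fun j _ => hμ j) fun h0 => ?_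
    have hz := (Finset.sum_eq_zero_iff_of_nonneg fun j _ => hμ j).mp h0.symm
    obtain ⟨u, hu⟩ := hne
    have h := hs (Φ u) ⟨u, hu, rfl⟩
    rw [hfμ, Finset.sum_eq_zero fun j hj => by rw [hz j hj, zero_mul]] at h
    linarith
  have hx : Finset.univ.centerMass μ y ∈ K :=
    hconv.centerMass_mem (fun j _ => hμ j) hpos fun j _ => hy j
  have hneg := hs _ ⟨_, hx, rfl⟩
  have key : (∑ j, μ j) * f (Φ (Finset.univ.centerMass μ y))
      = ∑ j, ∑ k, μ j * μ k * inner ℝ (y j - y k) (F (y j)) := by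
    rw [hfμ, Finset.mul_sum]
    refine Finset.sum_congr rfl fun j _ => ?_
    have e : (∑ k, μ k) • (y j - Finset.univ.centerMass μ y) = ∑ k, μ k • (y j - y k) := by
      simp only [Finset.centerMass, smul_sub, smul_inv_smul₀ hpos.ne', Finset.sum_sub_distrib,
        Finset.sum_smul]
    have e' := congrArg (fun v => μ j * inner ℝ v (F (y j))) e
    simp only [real_inner_smul_left, sum_inner, Finset.mul_sum] at e'
    simp only [hΦ]
    calc _ = μ j * ((∑ k, μ k) * inner ℝ (y j - Finset.univ.centerMass μ y) (F (y j))) := by ring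
      _ = _ := e'
      _ = _ := Finset.sum_congr rfl fun k _ => by ring
  have h0 := sum_sum_mul_inner_nonneg y μ hμ fun j k => hF _ (hy j) _ (hy k)
  rw [← key] at h0
  have := nonneg_of_mul_nonneg_right h0 hpos
  linarith

/-- A monotone map has a Minty point on every nonempty compact convex set; no continuity of `F` is
needed. -/
lemma exists_minty {K : Set E} {F : E → E}
    (hK : IsCompact K) (hconv : Convex ℝ K) (hne : K.Nonempty)
    (hF : ∀ x ∈ K, ∀ y ∈ K, 0 ≤ inner ℝ (x - y) (F x - F y)) :
    ∃ x ∈ K, ∀ y ∈ K, 0 ≤ inner ℝ (y - x) (F y) := by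
  obtain ⟨x, hxK, hx⟩ := hK.inter_iInter_nonempty
    (fun y : K => {x : E | 0 ≤ inner ℝ ((y : E) - x) (F y)})
    (fun y => isClosed_le continuous_const (by fun_prop))
    (fun u => by
      obtain ⟨x, hx, h⟩ := exists_minty_of_finite hK hconv hne hF
        (fun j : u => ((j : K) : E)) fun j => (j : K).2
      exact ⟨x, hx, Set.mem_iInter₂.mpr fun j hj => h ⟨j, hj⟩⟩)
  exact ⟨x, hxK, fun y hy => Set.mem_iInter.mp hx ⟨y, hy⟩⟩

/-- Minty's lemma: test at `x + t (z - x)`, divide by `t`, and let `t` decrease to `0`. -/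
lemma mem_viSolutions_of_minty {K : Set E} {F : E → E} (hconv : Convex ℝ K)
    (hF : ContinuousOn F K) {x : E} (hxK : x ∈ K)
    (hx : ∀ y ∈ K, 0 ≤ inner ℝ (y - x) (F y)) : x ∈ viSolutions K F := by
  refine ⟨hxK, fun z hz => ?_⟩
  have hmem : ∀ᶠ t : ℝ in 𝓝[>] 0, x + t • (z - x) ∈ K := by
    filter_upwards [Ioc_mem_nhdsGT (zero_lt_one' ℝ)] with t ht
    exact hconv.add_smul_sub_mem hxK hz ⟨ht.1.le, ht.2⟩
  have hlim : Tendsto (fun t : ℝ => x + t • (z - x)) (𝓝[>] 0) (𝓝[K] x) := by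
    refine tendsto_nhdsWithin_iff.mpr ⟨?_, hmem⟩
    have hc : Continuous fun t : ℝ => x + t • (z - x) := by fun_prop
    simpa using (hc.tendsto 0).mono_left nhdsWithin_le_nhds
  refine ge_of_tendsto (tendsto_const_nhds.inner ((hF x hxK).tendsto.comp hlim)) ?_
  filter_upwards [hmem, self_mem_nhdsWithin] with t ht ht0
  have h := hx _ ht
  rw [add_sub_cancel_left, real_inner_smul_left] at h
  exact nonneg_of_mul_nonneg_right h ht0

lemma StrictlyMonotoneOn.inner_nonneg {F : E → E} {S : Set E} (hF : StrictlyMonotoneOn F S)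
    {x y : E} (hx : x ∈ S) (hy : y ∈ S) : 0 ≤ inner ℝ (x - y) (F x - F y) := by
  rcases eq_or_ne x y with rfl | h
  · simp
  · exact (hF x hx y hy h).le

lemma StrictlyMonotoneOn.subsingleton_viSolutions {F : E → E} {K : Set E}
    (hF : StrictlyMonotoneOn F K) : (viSolutions K F).Subsingleton := by
  rintro x ⟨hxK, hx⟩ y ⟨hyK, hy⟩
  by_contra hne
  have h := hF x hxK y hyK hne
  have h1 := hx y hyK
  rw [← neg_sub, inner_neg_left] at h1
  rw [inner_sub_right] at h
  linarith [hy x hxK]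

theorem StrictlyMonotoneOn.existsUnique_mem_viSolutions {F : E → E} {K : Set E}
    (hF : StrictlyMonotoneOn F K) (hK : IsCompact K) (hconv : Convex ℝ K) (hne : K.Nonempty)
    (hcont : ContinuousOn F K) : ∃! x, x ∈ viSolutions K F := by
  obtain ⟨x, hxK, hx⟩ :=
    exists_minty hK hconv hne fun x hx y hy => hF.inner_nonneg hx hy
  have hsol := mem_viSolutions_of_minty hconv hcont hxK hx
  exact ⟨x, hsol, fun y hy => hF.subsingleton_viSolutions hy hsol⟩

end VariationalInequality

/-! ### The pseudo-gradient and the feasible set -/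

namespace AggregativeGame

variable {N m l : ℕ} {n : Fin N → ℕ} (G : AggregativeGame N m l n)

/-- The inclusion of the `i`-th factor into the space of strategy profiles. -/
noncomputable def profileSingle (n : Fin N → ℕ) (i : Fin N) :
    EuclideanSpace ℝ (Fin (n i)) →L[ℝ] Profile n :=
  ((PiLp.continuousLinearEquiv 2 ℝ fun i => EuclideanSpace ℝ (Fin (n i))).symm :
      (∀ i, EuclideanSpace ℝ (Fin (n i))) →L[ℝ] Profile n).comp
    (ContinuousLinearMap.single ℝ (fun i => EuclideanSpace ℝ (Fin (n i))) i)

lemma deviate_eq (x : Profile n) (i : Fin N) (y : EuclideanSpace ℝ (Fin (n i))) :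
    deviate x i y = x + profileSingle n i (y - x i) := by
  refine PiLp.ext fun j => ?_
  rcases eq_or_ne j i with rfl | h
  · simp [deviate, profileSingle]
  · simp [deviate, profileSingle, h]

/-- By the chain rule, the gradient in one player's own variable is the Riesz representative of the
full derivative restricted to that player's factor. -/
lemma pseudoGradient_apply {x : Profile n} {i : Fin N} (h : DifferentiableAt ℝ (G.cost i) x) :
    G.pseudoGradient x i = (InnerProductSpace.toDual ℝ (EuclideanSpace ℝ (Fin (n i)))).symm
      ((fderiv ℝ (G.cost i) x).comp (profileSingle n i)) := by
  have hd : HasFDerivAt (fun y => deviate x i y) (profileSingle n i) (x i) := by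
    simp only [deviate_eq]
    exact ((profileSingle n i).hasFDerivAt.comp (x i)
      ((hasFDerivAt_id (x i)).sub_const (x i))).const_add x
  have hx : deviate x i (x i) = x := by simp [deviate_eq]
  have hc : HasFDerivAt (fun y => G.cost i (deviate x i y))
      ((fderiv ℝ (G.cost i) x).comp (profileSingle n i)) (x i) :=
    HasFDerivAt.comp (g := G.cost i) (x i) (by rw [hx]; exact h.hasFDerivAt) hd
  simp only [pseudoGradient, gradient, hc.fderiv]

lemma continuousAt_pseudoGradient {x : Profile n} (h : ∀ i, ContDiffAt ℝ 2 (G.cost i) x) :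
    ContinuousAt G.pseudoGradient x := by
  have hcomp : ∀ i, ContinuousAt (fun z => G.pseudoGradient z i) x := fun i => by
    have hfd : ContinuousAt (fderiv ℝ (G.cost i)) x :=
      ((h i).fderiv_right (m := 1) (by norm_num)).continuousAt
    have hev : ∀ᶠ z in 𝓝 x, DifferentiableAt ℝ (G.cost i) z := by
      filter_upwards [(h i).eventually (by simp)] with z hz
      exact hz.differentiableAt (by simp)
    refine ContinuousAt.congr ?_
      (hev.mono fun z hz => (G.pseudoGradient_apply hz).symm)
    exact (LinearIsometryEquiv.continuous _).continuousAt.comp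
      (hfd.clm_comp continuousAt_const)
  exact (PiLp.continuous_toLp 2 _).continuousAt.comp (continuousAt_pi.mpr hcomp)

lemma continuous_sum_mulVec :
    Continuous fun x : Profile n => ∑ i, (G.A i).mulVec (x i) := by
  refine continuous_finsetSum _ fun i _ => ?_
  exact Continuous.matrix_mulVec continuous_const (by fun_prop)

lemma isClosed_coupledSet : IsClosed G.coupledSet :=
  isClosed_eq G.continuous_sum_mulVec continuous_const

lemma convex_coupledSet : Convex ℝ G.coupledSet := by
  intro x hx y hy a b _ _ hab
  simp only [coupledSet, Set.mem_ofPred_eq] at hx hy ⊢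
  simp only [PiLp.add_apply, PiLp.smul_apply, WithLp.ofLp_add, WithLp.ofLp_smul,
    Matrix.mulVec_add, Matrix.mulVec_smul, Finset.sum_add_distrib, ← Finset.smul_sum, hx, hy]
  rw [← add_smul, hab, one_smul]

lemma feasibleSet_nonempty (h : (0 : Profile n) ∈ G.strategySet - G.coupledSet) :
    G.feasibleSet.Nonempty := by
  obtain ⟨u, hu, v, hv, huv⟩ := Set.mem_sub.mp h
  obtain rfl := sub_eq_zero.mp huv
  exact ⟨u, hu, hv⟩

end AggregativeGame

theorem mainTheorem1 {N m l : ℕ} {n : Fin N → ℕ} (G : AggregativeGame N m l n)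
    (smooth : ∀ i, ∀ x ∈ G.strategySet, ContDiffAt ℝ 2 (G.cost i) x)
    (monotone : StrictlyMonotoneOn G.pseudoGradient G.strategySet)
    (compact : IsCompact G.strategySet)
    (convex : Convex ℝ G.strategySet)
    (qualification : (0 : Profile n) ∈ intrinsicInterior ℝ (G.strategySet - G.coupledSet)) :
    ∃! x : Profile n, G.IsVariationalGNE x := by
  have hmono : StrictlyMonotoneOn G.pseudoGradient G.feasibleSet :=
    fun x hx y hy => monotone x hx.1 y hy.1
  exact hmono.existsUnique_mem_viSolutions (compact.inter_right G.isClosed_coupledSet)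
    (convex.inter G.convex_coupledSet)
    (G.feasibleSet_nonempty (intrinsicInterior_subset qualification))
    fun x hx => (G.continuousAt_pseudoGradient fun i => smooth i x hx.1).continuousWithinAt
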